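/- Let $X$ be a finite set with at least two elements and let $T$ be the regular rooted tree whose vertices are the finite words over $X$ (the root is the empty word, and $x_1\cdots x_n$ is adjacent to $x_1\cdots x_{n-1}$). For an automorphism $g$ of the rooted tree $T$ and a word $v$, the state $g|_v$ is the automorphism of $T$ determined by $g(vu)=g(v)\,g|_v(u)$ for all words $u$. Let $\Theta_n(g)$ be the number of words $v$ of length $n$ with $g|_v\neq e$. Define the following groups of automorphisms of $T$: - $\mathrm{FAut}\,T$, the group of finite-state automorphisms, i.e. of the $g$ for which $\{g|_v : v\in X^*\}$ is finite; - $\mathrm{Pol}(m)$ ($m\ge 0$), the group of those $g\in \mathrm{FAut}\,T$ for which the sequence $\Theta_n(g)$ is bounded by a polynomial in $n$ of degree at most $m$; - $\mathrm{Pol}(\infty)=\bigcup_{m\ge 0}\mathrm{Pol}(m)$; - $\mathrm{RAut}\,T$, the group of functionally recursive automorphisms, i.e. the union of all finitely generated subgroups $K$ of $\mathrm{Aut}\,T$ that are self-similar ($g|_v\in K$ for all $g\in K$ and all words $v$). A minimal generating set of a group is a generating set no proper subset of which generates the group. A permutation group $(A,Y)$ satisfies **PS** if it is finite and transitive, and there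 are disjoint subsets $Y_1,Y_2\subseteq Y$ with $|Y_1|\ge 2$, $|Y_2|\ge 3$, and subgroups $A_1,A_2\le A$ such that $A_i$ acts transitively on $Y_i$ and trivially on $Y\setminus Y_i$ ($i=1,2$), and such that if $|Y_1|=2$ then some $a\in A$ satisfies $a(Y_1)\cap Y_2\neq\emptyset$ and $a(Y_1)\not\subseteq Y_2$. A group $G$ satisfies the **L-condition** if $G$ is isomorphic to a permutational wreath product $(A,Y)\wr H = H^Y\rtimes A$ and there are a normal subgroup $H_0$ of $H$ and an integer $k>1$ such that, with $H'$ the commutator subgroup of $H$ and $H^k=\langle h^k : h\in H\rangle$: 1. $(A,Y)$ satisfies **PS**; 2. $H/H_0$ has an infinite minimal generating set; 3. $|H/H_0|\ge |H_0|$; 4. either $H_0\le H'$ or $H'\lneq H_0\le H^kH'$; 5. if $H'\lneq H_0\le H^kH'$, then some minimal generating set of $H/H_0$ has a subset $C$ with $|C|=|H/H_0|$ such that every coset $c\in C$ contains an element of $H$ of order $k$. **Theorem.** Each of the groups $\mathrm{FAut}\,T$, $\mathrm{Pol}(m)$ for every $m\ge 0$, $\mathrm{Pol}(\infty)$, and $\mathrm{RAut}\,T$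 satisfies the L-condition and has a minimal generating set. -/

import Mathlib

/-- `S` is a minimal generating set of the group `G`: it generates `G`, and no proper subset
of it does. -/
def IsMinimalGeneratingSet {G : Type*} [Group G] (S : Set G) : Prop :=
  Minimal (fun T : Set G => Subgroup.closure T = ⊤) S

/-- The permutational wreath product `(A, Y) ≀ H`: the semidirect product of the direct power
`H ^ Y` with the permutation group `A`, which permutes the direct factors,
`(a • f) y = f (a⁻¹ y)`. -/
abbrev PermWreath {Y : Type*} (A : Subgroup (Equiv.Perm Y)) (H : Type*) [Group H] : Type _ :=
  (Y → H) ⋊[(mulAutArrow : A →* MulAut (Y → H))] A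

/-- The condition **PS** for a permutation group `(A, Y)`. -/
def ConditionPS {Y : Type*} (A : Subgroup (Equiv.Perm Y)) : Prop :=
  Finite Y ∧ MulAction.IsPretransitive A Y ∧
  ∃ (Y₁ Y₂ : Set Y) (A₁ A₂ : Subgroup (Equiv.Perm Y)), A₁ ≤ A ∧ A₂ ≤ A ∧
    (∀ x ∈ Y₁, ∀ y ∈ Y₁, ∃ a ∈ A₁, a x = y) ∧ (∀ a ∈ A₁, ∀ x ∉ Y₁, a x = x) ∧
    (∀ x ∈ Y₂, ∀ y ∈ Y₂, ∃ a ∈ A₂, a x = y) ∧ (∀ a ∈ A₂, ∀ x ∉ Y₂, a x = x) ∧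
    Disjoint Y₁ Y₂ ∧ 2 ≤ Y₁.ncard ∧ 3 ≤ Y₂.ncard ∧
    (Y₁.ncard = 2 → ∃ a ∈ A, ((a '' Y₁) ∩ Y₂).Nonempty ∧ ¬ (a '' Y₁ ⊆ Y₂))

/-- The verbal subgroup `H ^ k`, generated by all `k`-th powers. -/
def powerSubgroup (H : Type*) [Group H] (k : ℕ) : Subgroup H :=
  Subgroup.closure (Set.range fun h : H => h ^ k)

/-- The **L-condition**. The wreath factor `H` embeds in `G` and `Y` is finite, so the choice of
universes for them is no restriction. -/
def LCondition.{u} (G : Type u) [Group G] : Prop :=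
  ∃ (Y : Type) (A : Subgroup (Equiv.Perm Y)) (H : Type u) (_ : Group H)
    (H₀ : Subgroup H) (_ : H₀.Normal) (k : ℕ),
    Nonempty (G ≃* PermWreath A H) ∧ 1 < k ∧
    ConditionPS A ∧
    (∃ S : Set (H ⧸ H₀), S.Infinite ∧ IsMinimalGeneratingSet S) ∧
    Cardinal.mk H₀ ≤ Cardinal.mk (H ⧸ H₀) ∧
    (H₀ ≤ commutator H ∨ (commutator H < H₀ ∧ H₀ ≤ powerSubgroup H k ⊔ commutator H)) ∧
    ((commutator H < H₀ ∧ H₀ ≤ powerSubgroup H k ⊔ commutator H) →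
      ∃ S : Set (H ⧸ H₀), IsMinimalGeneratingSet S ∧ ∃ C ⊆ S,
        Cardinal.mk C = Cardinal.mk (H ⧸ H₀) ∧
        ∀ c ∈ C, ∃ h : H, (h : H ⧸ H₀) = c ∧ orderOf h = k)

namespace RegTree

/-- The regular rooted tree over the alphabet `X`: its vertices are the finite words over `X`,
the root is the empty word, and `x₁ ⋯ xₙ` is adjacent to `x₁ ⋯ xₙ₋₁`. -/
def tree (X : Type*) : SimpleGraph (List X) where
  Adj u v := (∃ x, v = u ++ [x]) ∨ (∃ x, u = v ++ [x])
  symm := ⟨fun _ _ h => h.symm⟩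
  loopless := ⟨fun u h => by rcases h with ⟨x, hx⟩ | ⟨x, hx⟩ <;> simp at hx⟩

/-- The automorphism group of the rooted tree: the bijections of the vertex set that preserve
the root and adjacency. -/
def TreeAut (X : Type*) : Subgroup (Equiv.Perm (List X)) where
  carrier := {g | g [] = [] ∧ ∀ u v, (tree X).Adj (g u) (g v) ↔ (tree X).Adj u v}
  one_mem' := ⟨rfl, fun _ _ => Iff.rfl⟩
  mul_mem' {a b} ha hb := ⟨by rw [Equiv.Perm.mul_apply, hb.1, ha.1],
    fun u v => (ha.2 (b u) (b v)).trans (hb.2 u v)⟩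
  inv_mem' {a} ha := ⟨by rw [Equiv.Perm.inv_eq_iff_eq, ha.1],
    fun u v => by simpa using (ha.2 (a⁻¹ u) (a⁻¹ v)).symm⟩

variable {X : Type*}

theorem adj_append (u : List X) (a b : List X) :
    (tree X).Adj (u ++ a) (u ++ b) ↔ (tree X).Adj a b := by
  simp [tree, List.append_assoc]

theorem apply_child (g : TreeAut X) (u : List X) (x : X) :
    ∃ y, g.1 (u ++ [x]) = g.1 u ++ [y] := by
  induction u using List.reverseRecOn generalizing x with
  | nil =>
    have h : (tree X).Adj (g.1 []) (g.1 ([] ++ [x])) := (g.2.2 _ _).2 (Or.inl ⟨x, rfl⟩)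
    rcases h with h | ⟨y, hy⟩
    · exact h
    · rw [g.2.1] at hy
      simp at hy
  | append_singleton w z ih =>
    have h : (tree X).Adj (g.1 (w ++ [z])) (g.1 (w ++ [z] ++ [x])) :=
      (g.2.2 _ _).2 (Or.inl ⟨x, rfl⟩)
    rcases h with h | ⟨y, hy⟩
    · exact h
    · obtain ⟨y', hy'⟩ := ih z
      rw [hy'] at hy
      have h1 : g.1 w = g.1 (w ++ [z] ++ [x]) := (List.append_inj' hy rfl).1
      have h2 := congrArg List.length (g.1.injective h1)
      simp at h2

theorem length_apply (g : TreeAut X) (u : List X) : (g.1 u).length = u.length := by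
  induction u using List.reverseRecOn with
  | nil => rw [g.2.1]
  | append_singleton w z ih =>
    obtain ⟨y, hy⟩ := apply_child g w z
    rw [hy]
    simp [ih]

theorem apply_append (g : TreeAut X) (v u : List X) :
    g.1 (v ++ u) = g.1 v ++ (g.1 (v ++ u)).drop v.length := by
  have key : ∃ w, g.1 (v ++ u) = g.1 v ++ w := by
    induction u using List.reverseRecOn with
    | nil => exact ⟨[], by simp⟩
    | append_singleton w z ih =>
      obtain ⟨w', hw'⟩ := ih
      obtain ⟨y, hy⟩ := apply_child g (v ++ w) z
      exact ⟨w' ++ [y], by rw [← List.append_assoc, hy, hw', List.append_assoc]⟩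
  obtain ⟨w, hw⟩ := key
  rw [hw, ← length_apply g v, List.drop_left]

theorem drop_inv_drop (g : TreeAut X) (v u : List X) :
    ((g⁻¹).1 (g.1 v ++ (g.1 (v ++ u)).drop v.length)).drop (g.1 v).length = u := by
  rw [← apply_append, length_apply]
  simp

/-- The state (section) `g|_v` of `g` at the vertex `v`: the automorphism with
`g (v u) = g(v) (g|_v (u))` for all words `u`. -/
def state (g : TreeAut X) (v : List X) : TreeAut X :=
  ⟨{ toFun := fun u => (g.1 (v ++ u)).drop v.length
     invFun := fun u => ((g⁻¹).1 (g.1 v ++ u)).drop (g.1 v).length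
     left_inv := fun u => drop_inv_drop g v u
     right_inv := fun u => by
      have h := drop_inv_drop g⁻¹ (g.1 v) u
      simpa using h }, by
    refine ⟨?_, fun a b => ?_⟩
    · change (g.1 (v ++ [])).drop v.length = []
      rw [List.append_nil, ← length_apply g v, List.drop_length]
    · change (tree X).Adj ((g.1 (v ++ a)).drop v.length) ((g.1 (v ++ b)).drop v.length) ↔ _
      rw [← adj_append (g.1 v), ← apply_append, ← apply_append, g.2.2, adj_append]⟩

theorem apply_append_state (g : TreeAut X) (v u : List X) :
    g.1 (v ++ u) = g.1 v ++ (state g v).1 u :=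
  apply_append g v u

theorem state_unique {g h : TreeAut X} {v : List X}
    (hh : ∀ u, g.1 (v ++ u) = g.1 v ++ h.1 u) : state g v = h := by
  apply Subtype.ext
  ext1 u
  have h1 := hh u
  rw [apply_append_state] at h1
  exact List.append_cancel_left h1

theorem state_one (v : List X) : state (1 : TreeAut X) v = 1 :=
  state_unique fun _ => rfl

theorem state_mul (g h : TreeAut X) (v : List X) :
    state (g * h) v = state g (h.1 v) * state h v :=
  state_unique fun u => by
    change g.1 (h.1 (v ++ u)) = g.1 (h.1 v) ++ (state g (h.1 v)).1 ((state h v).1 u)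
    rw [apply_append_state h, apply_append_state g]

theorem state_inv (g : TreeAut X) (v : List X) :
    state g⁻¹ v = (state g ((g⁻¹).1 v))⁻¹ := by
  rw [eq_inv_iff_mul_eq_one]
  have h := state_mul g⁻¹ g ((g⁻¹).1 v)
  rw [inv_mul_cancel, state_one] at h
  have h2 : g.1 ((g⁻¹).1 v) = v := by simp
  rw [h2] at h
  exact h.symm

/-- The group of finite-state automorphisms: those with finitely many states. -/
def FAut (X : Type*) : Subgroup (TreeAut X) where
  carrier := {g | (Set.range (state g)).Finite}
  one_mem' := (Set.finite_singleton (1 : TreeAut X)).subset (by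
    rintro _ ⟨v, rfl⟩
    exact state_one v)
  mul_mem' {a b} ha hb := (Set.Finite.image2 (fun x y => x * y) ha hb).subset (by
    rintro _ ⟨v, rfl⟩
    exact ⟨_, ⟨_, rfl⟩, _, ⟨_, rfl⟩, (state_mul a b v).symm⟩)
  inv_mem' {a} ha := (Set.Finite.image (fun x => x⁻¹) ha).subset (by
    rintro _ ⟨v, rfl⟩
    exact ⟨_, ⟨_, rfl⟩, (state_inv a v).symm⟩)

/-- `Θ_n(g)`: the number of words `v` of length `n` with `g|_v` nontrivial. -/
noncomputable def activity (g : TreeAut X) (n : ℕ) : ℕ :=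
  {v : List X | v.length = n ∧ state g v ≠ 1}.ncard

theorem finite_active [Finite X] (g : TreeAut X) (n : ℕ) :
    {v : List X | v.length = n ∧ state g v ≠ 1}.Finite :=
  (List.finite_length_eq X n).subset fun _ h => h.1

theorem activity_one (n : ℕ) : activity (1 : TreeAut X) n = 0 := by
  simp [activity, state_one]

theorem activity_mul_le [Finite X] (g h : TreeAut X) (n : ℕ) :
    activity (g * h) n ≤ activity g n + activity h n := by
  have h1 : (h.1 ⁻¹' {v : List X | v.length = n ∧ state g v ≠ 1}).ncard = activity g n :=
    Set.ncard_preimage_of_injective_subset_range h.1.injective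
      (by rw [h.1.surjective.range_eq]; exact Set.subset_univ _)
  rw [← h1]
  refine le_trans (Set.ncard_le_ncard ?_ ?_) (Set.ncard_union_le _ _)
  · rintro v ⟨hv, hs⟩
    by_cases hh : state h v = 1
    · refine Or.inl ⟨by rw [length_apply, hv], fun hg => hs ?_⟩
      rw [state_mul, hg, hh, one_mul]
    · exact Or.inr ⟨hv, hh⟩
  · exact ((finite_active g n).preimage h.1.injective.injOn).union (finite_active h n)

theorem activity_inv (g : TreeAut X) (n : ℕ) : activity g⁻¹ n = activity g n := by
  have h1 : ((g⁻¹).1 ⁻¹' {v : List X | v.length = n ∧ state g v ≠ 1}).ncard = activity g n :=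
    Set.ncard_preimage_of_injective_subset_range (g⁻¹).1.injective
      (by rw [(g⁻¹).1.surjective.range_eq]; exact Set.subset_univ _)
  rw [← h1, activity]
  congr 1
  ext v
  simp only [Set.mem_preimage, Set.mem_ofPred_eq, state_inv, length_apply, ne_eq, inv_eq_one]

/-- The group `Pol(m)`: finite-state automorphisms `g` for which `Θ_n(g)` is bounded by
a polynomial in `n` of degree at most `m`. -/
noncomputable def Pol (X : Type*) [Finite X] (m : ℕ) : Subgroup (TreeAut X) where
  carrier := {g | g ∈ FAut X ∧ ∃ p : Polynomial ℝ, p.natDegree ≤ m ∧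
    ∀ n : ℕ, (activity g n : ℝ) ≤ p.eval (n : ℝ)}
  one_mem' := ⟨one_mem _, 0, by simp, fun n => by simp [activity_one]⟩
  mul_mem' := by
    rintro a b ⟨ha, p, hp, hpa⟩ ⟨hb, q, hq, hqb⟩
    refine ⟨mul_mem ha hb, p + q, Polynomial.natDegree_add_le_of_degree_le hp hq, fun n => ?_⟩
    rw [Polynomial.eval_add]
    have h : (activity (a * b) n : ℝ) ≤ activity a n + activity b n := by
      exact_mod_cast activity_mul_le a b n
    linarith [hpa n, hqb n]
  inv_mem' := by
    rintro a ⟨ha, p, hp, hpa⟩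
    exact ⟨inv_mem ha, p, hp, fun n => by rw [activity_inv]; exact hpa n⟩

theorem pol_mono [Finite X] {m n : ℕ} (h : m ≤ n) : Pol X m ≤ Pol X n :=
  fun _ ⟨hg, p, hp, hpg⟩ => ⟨hg, p, hp.trans h, hpg⟩

/-- The group `Pol(∞)` of polynomial automorphisms, the union of the groups `Pol(m)`. -/
noncomputable def PolInf (X : Type*) [Finite X] : Subgroup (TreeAut X) where
  carrier := ⋃ m : ℕ, (Pol X m : Set (TreeAut X))
  one_mem' := Set.mem_iUnion.2 ⟨0, one_mem _⟩
  mul_mem' {a b} ha hb := by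
    obtain ⟨m, hm⟩ := Set.mem_iUnion.1 ha
    obtain ⟨n, hn⟩ := Set.mem_iUnion.1 hb
    exact Set.mem_iUnion.2 ⟨max m n,
      mul_mem (pol_mono (le_max_left m n) hm) (pol_mono (le_max_right m n) hn)⟩
  inv_mem' {a} ha := by
    obtain ⟨m, hm⟩ := Set.mem_iUnion.1 ha
    exact Set.mem_iUnion.2 ⟨m, inv_mem (show a ∈ Pol X m from hm)⟩

/-- A group of tree automorphisms is self-similar if it contains all states of its elements. -/
def IsSelfSimilar (K : Subgroup (TreeAut X)) : Prop :=
  ∀ g ∈ K, ∀ v : List X, state g v ∈ K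

theorem IsSelfSimilar.sup {K L : Subgroup (TreeAut X)} (hK : IsSelfSimilar K)
    (hL : IsSelfSimilar L) : IsSelfSimilar (K ⊔ L) := by
  intro g hg
  rw [← Subgroup.closure_eq K, ← Subgroup.closure_eq L, ← Subgroup.closure_union] at hg
  induction hg using Subgroup.closure_induction with
  | mem x hx =>
    intro v
    rcases hx with hx | hx
    · exact Subgroup.mem_sup_left (hK x hx v)
    · exact Subgroup.mem_sup_right (hL x hx v)
  | one =>
    intro v
    rw [state_one]
    exact one_mem _
  | mul x y _ _ hx hy =>
    intro v
    rw [state_mul]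
    exact mul_mem (hx _) (hy _)
  | inv x _ hx =>
    intro v
    rw [state_inv]
    exact inv_mem (hx _)

theorem isSelfSimilar_bot : IsSelfSimilar (⊥ : Subgroup (TreeAut X)) := by
  intro g hg v
  rw [Subgroup.mem_bot] at hg ⊢
  rw [hg, state_one]

/-- The group of functionally recursive automorphisms: the union of all finitely generated
self-similar groups of tree automorphisms. -/
def RAut (X : Type*) : Subgroup (TreeAut X) where
  carrier := {g | ∃ K : Subgroup (TreeAut X), K.FG ∧ IsSelfSimilar K ∧ g ∈ K}
  one_mem' := ⟨⊥, ⟨∅, by simp⟩, isSelfSimilar_bot, one_mem _⟩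
  mul_mem' := by
    rintro a b ⟨K, hK, hKs, ha⟩ ⟨L, hL, hLs, hb⟩
    exact ⟨K ⊔ L, hK.sup hL, hKs.sup hLs,
      mul_mem (Subgroup.mem_sup_left ha) (Subgroup.mem_sup_right hb)⟩
  inv_mem' := by
    rintro a ⟨K, hK, hKs, ha⟩
    exact ⟨K, hK, hKs, inv_mem ha⟩

end RegTree

/-!
Each of the groups `G` in question is countable and closed under the wreath recursion: it contains
the states of its elements and every automorphism of the tree whose states at the first level lie
in `G` (`IsRegularBranching`). Splitting the elements according to their action on the third
level gives `G ≃* (A, Y) ≀ G`, with `Y` the set of words of length three (`levelEquiv`). The words with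
first letter `x₀` and those with first letter `x₁` form two blocks of at least four points, conjugate
under `A`, so `A` satisfies **PS** (`conjugateBlocks`).

For the rest of the L-condition take `k = 2` and `H₀ = G ^ 2 G'`. The quotient `G / H₀` is a vector
space over the field with two elements. The product of the signs of the local permutations on level
`n` is a character of `G`, and the involutions `levelSwap n`, acting by one transposition on level `n`,
are dual to these characters. They are therefore independent modulo `H₀`, and their classes extend to
an infinite basis (`lCondition_of_dual`). Since `G` is countable, `|G / H₀| ≥ |H₀|`. Countability holds
because a functionally recursive automorphism is determined by finite data (`countable_rAut`).

For the minimal generating set, lift the basis to elements `h b`, using the involutions where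
possible, and consider the elements of the wreath product with `h b` at a coordinate of the first
block and `g b ∈ H₀` at a coordinate of the second one. Here `g b` is trivial unless `h b` is one of the
involutions, and every element of `H₀` occurs. Together with the finite group `A` they generate
the wreath product (`eq_top_of_wreath_generators`). Multiplying the coordinates modulo `H₀` maps them
back to the basis and kills `A`, so none of them is redundant, and it remains to shrink the finite set
`A` (`exists_isMinimalGeneratingSet_of_union`).
-/

open scoped commutatorElement

/-! ### Minimal generating sets -/

theorem isMinimalGeneratingSet_iff {G : Type*} [Group G] {S : Set G} :
    IsMinimalGeneratingSet S ↔
      Subgroup.closure S = ⊤ ∧ ∀ s ∈ S, s ∉ Subgroup.closure (S \ {s}) := by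
  refine ⟨fun h => ⟨h.prop, fun s hs hmem => ?_⟩, fun ⟨h1, h2⟩ => ⟨h1, fun T hT hTS s hs => ?_⟩⟩
  · have h1 : Subgroup.closure (S \ {s}) = ⊤ := by
      refine top_le_iff.1 (h.prop ▸ (Subgroup.closure_le _).2 fun t ht => ?_)
      by_cases hts : t = s
      · exact hts ▸ hmem
      · exact Subgroup.subset_closure ⟨ht, hts⟩
    exact (h.le_of_le h1 Set.sdiff_subset hs).2 rfl
  · by_contra hsT
    have hsub : T ⊆ S \ {s} := fun t ht => ⟨hTS ht, fun h => hsT (h ▸ ht)⟩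
    exact h2 s hs (Subgroup.closure_mono hsub (hT ▸ Subgroup.mem_top s))

theorem IsMinimalGeneratingSet.image {G G' : Type*} [Group G] [Group G'] (e : G ≃* G') {S : Set G}
    (hS : IsMinimalGeneratingSet S) : IsMinimalGeneratingSet (e '' S) := by
  obtain ⟨h1, h2⟩ := isMinimalGeneratingSet_iff.1 hS
  have hcl : ∀ T : Set G, Subgroup.closure (e '' T) = (Subgroup.closure T).map e.toMonoidHom :=
    fun T => (MonoidHom.map_closure e.toMonoidHom T).symm
  refine isMinimalGeneratingSet_iff.2 ⟨?_, ?_⟩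
  · rw [hcl, h1]
    exact Subgroup.map_top_of_surjective _ e.surjective
  · rintro _ ⟨s, hs, rfl⟩ hmem
    rw [← Set.image_singleton, ← Set.image_sdiff e.injective, hcl] at hmem
    obtain ⟨t, ht, hts⟩ := hmem
    exact h2 s hs (e.injective hts ▸ ht)

/-- In a group of exponent two, viewed as a vector space over `ZMod 2`, an independent set extends
to a basis, that is, to a minimal generating set. -/
theorem exists_isMinimalGeneratingSet_superset {V : Type*} [Group V] (hV : ∀ x : V, x ^ 2 = 1)
    {C : Set V} (hC : ∀ c ∈ C, c ∉ Subgroup.closure (C \ {c})) :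
    ∃ S, C ⊆ S ∧ IsMinimalGeneratingSet S := by
  let _ : CommGroup V :=
    { (inferInstance : Group V) with
      mul_comm := fun a b => by
        have hinv : ∀ x : V, x⁻¹ = x := fun x => inv_eq_of_mul_eq_one_left (by rw [← sq, hV])
        rw [← hinv (a * b), mul_inv_rev, hinv, hinv] }
  let _ : Module (ZMod 2) (Additive V) := AddCommGroup.zmodModule (n := 2) fun x => hV x.toMul
  have hspan (s : Set (Additive V)) :
      Submodule.span (ZMod 2) s = AddSubgroup.toZModSubmodule 2 (AddSubgroup.closure s) :=
    le_antisymm (Submodule.span_le.2 AddSubgroup.subset_closure)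
      ((AddSubgroup.closure_le (Submodule.span (ZMod 2) s).toAddSubgroup).2 Submodule.subset_span)
  have hmem (s : Set V) (x : V) : Additive.ofMul x ∈ Submodule.span (ZMod 2) (Additive.toMul ⁻¹' s) ↔
      x ∈ Subgroup.closure s := by
    rw [hspan, ← Subgroup.toAddSubgroup_closure]
    rfl
  have key (s : Set V) : LinearIndepOn (ZMod 2) id (Additive.toMul ⁻¹' s) ↔
      ∀ c ∈ s, c ∉ Subgroup.closure (s \ {c}) := by
    rw [linearIndepOn_iff_notMem_span]
    simp only [Set.image_id]
    exact forall₂_congr fun c hc => not_congr (hmem (s \ {c}) c)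
  have hli := (key C).2 hC
  have hext := hli.linearIndepOn_extend (Set.subset_univ _)
  refine ⟨Additive.ofMul ⁻¹' hli.extend (Set.subset_univ _),
    hli.subset_extend (Set.subset_univ _), isMinimalGeneratingSet_iff.2 ⟨?_, (key _).1 hext⟩⟩
  refine top_le_iff.1 fun x _ => (hmem _ x).1 ?_
  exact hli.subset_span_extend (Set.subset_univ _) (Set.mem_univ (Additive.ofMul x))

/-- If `φ` maps the elements `s b` to the members `b` of a minimal generating set `B` and kills the
finite set `F`, then a generating set `s '' B ∪ F` contains a minimal one: no `s b` can be dropped, so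
it is enough to shrink `F`. -/
theorem exists_isMinimalGeneratingSet_of_union {G V : Type*} [Group G] [Group V] (φ : G →* V)
    {B : Set V} (hB : IsMinimalGeneratingSet B) {s : V → G} (hs : ∀ b ∈ B, φ (s b) = b)
    {F : Set G} (hF : F.Finite) (hφF : ∀ x ∈ F, φ x = 1)
    (hφ : Function.Surjective φ)
    (hgen : Subgroup.closure (s '' B ∪ F) = ⊤) :
    ∃ S : Set G, IsMinimalGeneratingSet S := by
  obtain ⟨F', hF'⟩ := (hF.finite_subsets.subset (Set.sep_subset {E | E ⊆ F}
    fun E => Subgroup.closure (s '' B ∪ E) = ⊤)).exists_minimal ⟨F, Set.Subset.rfl, hgen⟩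
  obtain ⟨⟨hF'F, hgen'⟩, hmin⟩ := hF'
  refine ⟨s '' B ∪ F', hgen', fun T hT hTS => ?_⟩
  have hsT : s '' B ⊆ T := by
    rintro _ ⟨b, hb, rfl⟩
    by_contra hbT
    refine (isMinimalGeneratingSet_iff.1 hB).2 b hb ?_
    have h : (⊤ : Subgroup G).map φ ≤ Subgroup.closure (B \ {b}) := by
      rw [← hT, MonoidHom.map_closure, Subgroup.closure_le]
      rintro _ ⟨t, ht, rfl⟩
      rcases hTS ht with ⟨c, hc, rfl⟩ | htF
      · rw [hs c hc]
        refine Subgroup.subset_closure ⟨hc, ?_⟩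
        rintro rfl
        exact hbT ht
      · rw [hφF t (hF'F htF)]
        exact one_mem _
    rw [← MonoidHom.range_eq_map, MonoidHom.range_eq_top.2 hφ] at h
    exact h (Subgroup.mem_top b)
  have hT' : T = s '' B ∪ (T ∩ F') := by
    rw [Set.union_inter_distrib_left, Set.union_eq_self_of_subset_left hsT,
      Set.inter_eq_left.2 hTS]
  have h := hmin (y := T ∩ F') ⟨Set.inter_subset_right.trans hF'F, hT' ▸ hT⟩ Set.inter_subset_right
  exact Set.union_subset hsT (h.trans Set.inter_subset_left)

/-! ### Generating a permutational wreath product -/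

/-- In a group generated by a set whose elements commute and have trivial `k`-th powers modulo a
normal subgroup `M`, the subgroup `M` contains all commutators and `k`-th powers. -/
theorem powerSubgroup_sup_commutator_le {H : Type*} [Group H] {M : Subgroup H} [hM : M.Normal]
    {T : Set H} (hT : Subgroup.closure T = ⊤) (hcomm : ∀ x ∈ T, ∀ y ∈ T, ⁅x, y⁆ ∈ M) {k : ℕ}
    (hpow : ∀ x ∈ T, x ^ k ∈ M) : powerSubgroup H k ⊔ commutator H ≤ M := by
  have h1 : ∀ x ∈ T, ∀ z, ⁅x, z⁆ ∈ M := by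
    intro x hx z
    have hle : Subgroup.closure T ≤
        (Subgroup.centralizer {(x : H ⧸ M)}).comap (QuotientGroup.mk' M) := by
      rw [Subgroup.closure_le]
      intro y hy
      have := (QuotientGroup.eq_one_iff _).2 (hcomm x hx y hy)
      rw [← QuotientGroup.mk'_apply, map_commutatorElement, commutatorElement_eq_one_iff_mul_comm]
        at this
      simpa [Subgroup.mem_centralizer_iff] using this
    have hz := hle (hT ▸ Subgroup.mem_top z)
    rw [← QuotientGroup.eq_one_iff, ← QuotientGroup.mk'_apply, map_commutatorElement,
      commutatorElement_eq_one_iff_mul_comm]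
    simpa [Subgroup.mem_centralizer_iff] using hz
  have h2 : ∀ w z : H, ⁅w, z⁆ ∈ M := by
    intro w z
    have hle : Subgroup.closure T ≤
        (Subgroup.centralizer {(z : H ⧸ M)}).comap (QuotientGroup.mk' M) := by
      rw [Subgroup.closure_le]
      intro y hy
      have := (QuotientGroup.eq_one_iff _).2 (h1 y hy z)
      rw [← QuotientGroup.mk'_apply, map_commutatorElement, commutatorElement_eq_one_iff_mul_comm]
        at this
      simpa [Subgroup.mem_centralizer_iff] using this.symm
    have hz := hle (hT ▸ Subgroup.mem_top w)
    rw [← QuotientGroup.eq_one_iff, ← QuotientGroup.mk'_apply, map_commutatorElement,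
      commutatorElement_eq_one_iff_mul_comm]
    exact (Subgroup.mem_centralizer_iff.1 hz _ rfl).symm
  have hc : commutator H ≤ M := by
    rw [commutator_def, Subgroup.commutator_le]
    exact fun a _ b _ => h2 a b
  refine sup_le ?_ hc
  let _ : CommGroup (H ⧸ M) :=
    { (inferInstance : Group (H ⧸ M)) with
      mul_comm := (Subgroup.Normal.quotient_commutative_iff_commutator_le.2 hc).is_comm.comm }
  have hle : Subgroup.closure T ≤ ((powMonoidHom k).comp (QuotientGroup.mk' M)).ker := by
    rw [Subgroup.closure_le]
    exact fun x hx => (QuotientGroup.eq_one_iff _).2 (hpow x hx)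
  rw [powerSubgroup, Subgroup.closure_le]
  rintro _ ⟨x, rfl⟩
  exact (QuotientGroup.eq_one_iff _).1 (hle (hT ▸ Subgroup.mem_top x))

/-- Disjoint sets `Y₁`, `Y₂` with at least three points, conjugate under the transitive permutation
group `A`, on each of which `A` acts transitively by permutations fixing all other points. -/
structure ConjugateBlocks {Y : Type*} (A : Subgroup (Equiv.Perm Y)) (Y₁ Y₂ : Set Y) : Prop where
  trans : ∀ y y', ∃ a ∈ A, a y = y'
  disjoint : Disjoint Y₁ Y₂
  trans_left : ∀ x ∈ Y₁, ∀ y ∈ Y₁, ∃ a ∈ A, a x = y ∧ ∀ z ∉ Y₁, a z = z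
  trans_right : ∀ x ∈ Y₂, ∀ y ∈ Y₂, ∃ a ∈ A, a x = y ∧ ∀ z ∉ Y₂, a z = z
  three_le_ncard : 3 ≤ Y₁.ncard
  conj : ∃ a ∈ A, a '' Y₂ = Y₁

theorem ConjugateBlocks.ncard_eq {Y : Type*} {A : Subgroup (Equiv.Perm Y)} {Y₁ Y₂ : Set Y}
    (hY : ConjugateBlocks A Y₁ Y₂) : Y₂.ncard = Y₁.ncard := by
  obtain ⟨a, -, rfl⟩ := hY.conj
  exact (Set.ncard_image_of_injective _ a.injective).symm

theorem ConjugateBlocks.conditionPS {Y : Type*} [Finite Y] {A : Subgroup (Equiv.Perm Y)}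
    {Y₁ Y₂ : Set Y} (hY : ConjugateBlocks A Y₁ Y₂) : ConditionPS A := by
  refine ⟨inferInstance, ⟨fun x y => ?_⟩, Y₁, Y₂,
    A ⊓ fixingSubgroup (Equiv.Perm Y) Y₁ᶜ, A ⊓ fixingSubgroup (Equiv.Perm Y) Y₂ᶜ,
    inf_le_left, inf_le_left, fun x hx y hy => ?_, fun a ha x hx => ha.2 ⟨x, hx⟩,
    fun x hx y hy => ?_, fun a ha x hx => ha.2 ⟨x, hx⟩, hY.disjoint,
    le_trans (by norm_num) hY.three_le_ncard, hY.ncard_eq ▸ hY.three_le_ncard, fun h => ?_⟩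
  · obtain ⟨a, ha, hxy⟩ := hY.trans x y
    exact ⟨⟨a, ha⟩, hxy⟩
  · obtain ⟨a, ha, hxy, hfix⟩ := hY.trans_left x hx y hy
    exact ⟨a, ⟨ha, fun z => hfix z z.2⟩, hxy⟩
  · obtain ⟨a, ha, hxy, hfix⟩ := hY.trans_right x hx y hy
    exact ⟨a, ⟨ha, fun z => hfix z z.2⟩, hxy⟩
  · have := hY.three_le_ncard
    omega

/-- Let `P ≤ H ^ Y` be invariant under `A`. If `P` contains all `h i` at `y₁ ∈ Y₁` times `g i` at
`y₂ ∈ Y₂`, the `h i` and `g i` generate `H`, and the `g i` are products of commutators and `k`-th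
powers which are trivial unless `h i` has trivial `k`-th power, then `P = H ^ Y`.

Moving one of the two coordinates isolates quotients `(h at y)(h⁻¹ at y')`, whose commutators show
that the subgroup `M` of all `m` for which `P` contains `m` at one coordinate is normal and
contains `H'`. The `k`-th powers of the generators then yield `H ^ k ≤ M`, so `M` contains all `g
i` and finally all `h i`. -/
theorem eq_top_of_wreath_generators {Y H ι : Type*} [Finite Y] [DecidableEq Y] [Group H]
    {A : Subgroup (Equiv.Perm Y)} (P : Subgroup (Y → H))
    (hP : ∀ a ∈ A, ∀ y y' h h', Pi.mulSingle y h * Pi.mulSingle y' h' ∈ P →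
      Pi.mulSingle (a y) h * Pi.mulSingle (a y') h' ∈ P)
    {Y₁ Y₂ : Set Y} (hY : ConjugateBlocks A Y₁ Y₂)
    {y₁ y₂ : Y} (hy₁ : y₁ ∈ Y₁) (hy₂ : y₂ ∈ Y₂) {h g : ι → H} {k : ℕ}
    (hgen : Subgroup.closure (Set.range h ∪ Set.range g) = ⊤)
    (hg : ∀ i, g i ∈ powerSubgroup H k ⊔ commutator H)
    (hhg : ∀ i, h i ^ k = 1 ∨ g i = 1)
    (hmem : ∀ i, Pi.mulSingle y₁ (h i) * Pi.mulSingle y₂ (g i) ∈ P) : P = ⊤ := by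
  obtain ⟨htrans, hdisj, h₁, h₂, hcard, s, hsA, hs'⟩ := hY
  have hs : ∀ y ∈ Y₁, s⁻¹ y ∈ Y₂ := by
    rw [← hs']
    rintro _ ⟨y, hy, rfl⟩
    simpa using hy
  have hP1 : ∀ a ∈ A, ∀ y h, Pi.mulSingle y h ∈ P → Pi.mulSingle (a y) h ∈ P := by
    intro a ha y h hh
    simpa using hP a ha y y h 1 (by simpa using hh)
  -- Moving only the coordinate in `Y₁` isolates the `h i`; moving only the one in `Y₂` isolates the
  -- `g i`, with quotients on `Y₂` that are then carried over to `Y₁`.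
  have hdiff : ∀ t ∈ Set.range h ∪ Set.range g, ∀ y ∈ Y₁, ∀ y' ∈ Y₁,
      Pi.mulSingle y t * Pi.mulSingle y' t⁻¹ ∈ P := by
    rintro _ (⟨i, rfl⟩ | ⟨i, rfl⟩) y hy y' hy'
    · obtain ⟨a, ha, hay, haY⟩ := h₁ y₁ hy₁ y hy
      obtain ⟨b, hb, hby, hbY⟩ := h₁ y₁ hy₁ y' hy'
      have ha' := hP a ha _ _ _ _ (hmem i)
      have hb' := hP b hb _ _ _ _ (hmem i)
      have hy₂' := hdisj.notMem_of_mem_right hy₂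
      rw [hay, haY _ hy₂'] at ha'
      rw [hby, hbY _ hy₂'] at hb'
      have := mul_mem ha' (inv_mem hb')
      rwa [mul_inv_rev, mul_assoc, mul_inv_cancel_left, ← Pi.mulSingle_inv] at this
    · have key : ∀ z ∈ Y₂, ∀ z' ∈ Y₂, z ≠ z' →
          Pi.mulSingle z (g i) * Pi.mulSingle z' (g i)⁻¹ ∈ P := by
        intro z hz z' hz' hne
        obtain ⟨a, ha, hay, haY⟩ := h₂ y₂ hy₂ z hz
        obtain ⟨b, hb, hby, hbY⟩ := h₂ y₂ hy₂ z' hz'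
        have ha' := hP a ha _ _ _ _ (hmem i)
        have hb' := hP b hb _ _ _ _ (hmem i)
        have hy₁' := hdisj.notMem_of_mem_left hy₁
        rw [hay, haY _ hy₁'] at ha'
        rw [hby, hbY _ hy₁'] at hb'
        have := mul_mem (inv_mem hb') ha'
        rw [mul_inv_rev, mul_assoc, inv_mul_cancel_left, ← Pi.mulSingle_inv] at this
        rwa [(Pi.mulSingle_commute (f := fun _ : Y => H) hne (g i) (g i)⁻¹).eq]
      rcases eq_or_ne y y' with rfl | hne
      · rw [Pi.mulSingle_inv, mul_inv_cancel]
        exact one_mem _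
      · have := hP s hsA _ _ _ _ (key _ (hs y hy) _ (hs y' hy') (fun h => hne (by simpa using h)))
        simpa using this
  let M : Subgroup H := P.comap (MonoidHom.mulSingle (fun _ : Y => H) y₁)
  have hM : ∀ m, m ∈ M ↔ Pi.mulSingle y₁ m ∈ P := fun _ => Iff.rfl
  obtain ⟨b, c, hb, hc, hb₁, hc₁, hbc⟩ : ∃ b c, b ∈ Y₁ ∧ c ∈ Y₁ ∧ b ≠ y₁ ∧ c ≠ y₁ ∧ b ≠ c := by
    have h2 : 1 < (Y₁ \ {y₁}).ncard := by
      rw [Set.ncard_sdiff_singleton_of_mem hy₁]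
      omega
    obtain ⟨b, c, hb, hc, hbc⟩ := (Set.one_lt_ncard_iff (Set.toFinite _)).1 h2
    exact ⟨b, c, hb.1, hc.1, hb.2, hc.2, hbc⟩
  have hnormal : M.Normal := by
    rw [← Subgroup.normalizer_eq_top_iff, ← top_le_iff, ← hgen, Subgroup.closure_le]
    intro t ht
    rw [SetLike.mem_coe, Subgroup.mem_normalizer_iff]
    intro m
    have hd := hdiff t ht y₁ hy₁ b hb
    -- The coordinate `t⁻¹` at `b` does not matter when conjugating an element supported at `y₁`.
    have heq : Pi.mulSingle y₁ (t * m * t⁻¹) =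
        (Pi.mulSingle y₁ t * Pi.mulSingle b t⁻¹ : Y → H) * Pi.mulSingle y₁ m *
          (Pi.mulSingle y₁ t * Pi.mulSingle b t⁻¹ : Y → H)⁻¹ := by
      funext z
      rcases eq_or_ne z y₁ with rfl | hz
      · simp [Pi.mulSingle_eq_of_ne hb₁.symm]
      · simp [Pi.mulSingle_eq_of_ne hz]
    rw [hM, hM, heq, P.mul_mem_cancel_right (inv_mem hd), P.mul_mem_cancel_left hd]
  have hcomm : ∀ x ∈ Set.range h ∪ Set.range g, ∀ y ∈ Set.range h ∪ Set.range g, ⁅x, y⁆ ∈ M := by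
    intro t ht u hu
    -- With a third point `c ≠ b` of `Y₁`, the two supports meet only in `y₁`.
    have heq : (Pi.mulSingle y₁ ⁅t, u⁆ : Y → H) =
        ⁅(Pi.mulSingle y₁ t * Pi.mulSingle b t⁻¹ : Y → H),
          (Pi.mulSingle y₁ u * Pi.mulSingle c u⁻¹ : Y → H)⁆ := by
      funext z
      simp only [commutatorElement_def, Pi.mul_apply, Pi.inv_apply]
      rcases eq_or_ne z y₁ with rfl | hz
      · simp [Pi.mulSingle_eq_of_ne hb₁.symm, Pi.mulSingle_eq_of_ne hc₁.symm]
      · rcases eq_or_ne z b with rfl | hzb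
        · simp [Pi.mulSingle_eq_of_ne hz, Pi.mulSingle_eq_of_ne hbc]
        · simp [Pi.mulSingle_eq_of_ne hz, Pi.mulSingle_eq_of_ne hzb]
    rw [hM, heq, commutatorElement_def]
    have hd := hdiff t ht y₁ hy₁ b hb
    have hd' := hdiff u hu y₁ hy₁ c hc
    exact mul_mem (mul_mem (mul_mem hd hd') (inv_mem hd)) (inv_mem hd')
  have hall : ∀ m ∈ M, ∀ y, Pi.mulSingle y m ∈ P := by
    intro m hm y
    obtain ⟨a, ha, rfl⟩ := htrans y₁ y
    exact hP1 a ha _ _ hm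
  have hMof : ∀ y m, Pi.mulSingle y m ∈ P → m ∈ M := by
    intro y m hm
    obtain ⟨a, ha, hay⟩ := htrans y y₁
    have := hP1 a ha _ _ hm
    rwa [hay] at this
  have hne : y₁ ≠ y₂ := hdisj.ne_of_mem hy₁ hy₂
  have hpow : ∀ x ∈ Set.range h ∪ Set.range g, x ^ k ∈ M := by
    have hsplit : ∀ i, h i ^ k ∈ M ∧ g i ^ k ∈ M := by
      intro i
      -- If `h i ^ k = 1`, the `k`-th power of the given element is `g i ^ k` at `y₂`.
      rcases hhg i with hi | hi
      · refine ⟨hi ▸ one_mem _, hMof y₂ _ ?_⟩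
        have := pow_mem (hmem i) k
        rwa [(Pi.mulSingle_commute (f := fun _ : Y => H) hne (h i) (g i)).mul_pow,
          ← Pi.mulSingle_pow, ← Pi.mulSingle_pow, hi, Pi.mulSingle_one, one_mul] at this
      · refine ⟨pow_mem ((hM _).2 ?_) k, ?_⟩
        · simpa [hi] using hmem i
        · rw [hi, one_pow]
          exact one_mem _
    rintro _ (⟨i, rfl⟩ | ⟨i, rfl⟩)
    exacts [(hsplit i).1, (hsplit i).2]
  have hle := powerSubgroup_sup_commutator_le hgen hcomm hpow
  have htop : M = ⊤ := by
    rw [← top_le_iff, ← hgen, Subgroup.closure_le]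
    rintro _ (⟨i, rfl⟩ | ⟨i, rfl⟩)
    · exact (P.mul_mem_cancel_right (hall _ (hle (hg i)) y₂)).1 (hmem i)
    · exact hle (hg i)
  exact top_le_iff.1 fun f _ => Subgroup.pi_mem_of_mulSingle_mem f
    fun y => hall _ (htop ▸ Subgroup.mem_top _) y

/-! ### The L-condition and minimal generating sets for exponent two -/

section

variable {G : Type*} [Group G] {a : ℕ → G} {ε : ℕ → G →* ℤˣ}

/-- The subgroup `G ^ 2 G'`, the kernel of the projection of `G` onto its largest quotient of
exponent two. -/
abbrev elementaryKernel (G : Type*) [Group G] : Subgroup G :=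
  powerSubgroup G 2 ⊔ commutator G

instance normal_elementaryKernel : (elementaryKernel G).Normal :=
  Subgroup.Normal.of_commutator_le (G := G) le_sup_right

theorem pow_eq_one_quotient (x : G ⧸ elementaryKernel G) : x ^ 2 = 1 := by
  induction x using QuotientGroup.induction_on with | H x =>
  rw [← QuotientGroup.mk_pow, QuotientGroup.eq_one_iff]
  exact Subgroup.mem_sup_left (Subgroup.subset_closure ⟨x, rfl⟩)

theorem powerSubgroup_two_sup_commutator_le_ker (f : G →* ℤˣ) :
    elementaryKernel G ≤ f.ker := by
  refine sup_le ((Subgroup.closure_le _).2 ?_) (Abelianization.commutator_subset_ker f)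
  rintro _ ⟨x, rfl⟩
  exact (map_pow f x 2).trans (Int.units_sq _)

/-- Elements separated by a dual family of sign characters are independent modulo squares and
commutators, hence part of a basis of `G / G ^ 2 G'`. -/
theorem exists_isMinimalGeneratingSet_range_subset
    (hε : ∀ m n, ε m (a n) = if m = n then -1 else 1) :
    ∃ S : Set (G ⧸ elementaryKernel G),
      Set.range (fun n => (a n : G ⧸ elementaryKernel G)) ⊆ S ∧
      IsMinimalGeneratingSet S := by
  refine exists_isMinimalGeneratingSet_superset pow_eq_one_quotient ?_
  rintro _ ⟨n, rfl⟩ hn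
  let f : G ⧸ elementaryKernel G →* ℤˣ :=
    QuotientGroup.lift _ (ε n) (powerSubgroup_two_sup_commutator_le_ker (ε n))
  have hle : Subgroup.closure (Set.range
      (fun n => (a n : G ⧸ elementaryKernel G)) \ {↑(a n)}) ≤ f.ker := by
    rw [Subgroup.closure_le]
    rintro _ ⟨⟨m, rfl⟩, hm⟩
    have hne : n ≠ m := by
      rintro rfl
      exact hm rfl
    exact (hε n m).trans (if_neg hne)
  have h1 : ε n (a n) = 1 := hle hn
  rw [hε, if_pos rfl] at h1
  exact absurd h1 (by decide)

theorem mk_injective_of_dual (hε : ∀ m n, ε m (a n) = if m = n then -1 else 1) :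
    Function.Injective (fun n => (a n : G ⧸ elementaryKernel G)) := by
  intro m n hmn
  by_contra hne
  have h : ε m (a m) = ε m (a n) := congrArg
    (QuotientGroup.lift _ (ε m) (powerSubgroup_two_sup_commutator_le_ker (ε m))) hmn
  rw [hε, hε, if_pos rfl, if_neg hne] at h
  exact absurd h (by decide)

variable {Y : Type} [Finite Y] {A : Subgroup (Equiv.Perm Y)} {Y₁ Y₂ : Set Y}

theorem lCondition_of_dual [Countable G] (e : G ≃* PermWreath A G) (hY : ConjugateBlocks A Y₁ Y₂)
    (ha : ∀ n, a n ^ 2 = 1) (hε : ∀ m n, ε m (a n) = if m = n then -1 else 1) :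
    LCondition G := by
  obtain ⟨S, hS, hmin⟩ := exists_isMinimalGeneratingSet_range_subset hε
  have hinj := mk_injective_of_dual hε
  have : Infinite (G ⧸ elementaryKernel G) := .of_injective _ hinj
  refine ⟨Y, A, G, inferInstance, elementaryKernel G, inferInstance, 2, ⟨e⟩,
    one_lt_two, hY.conditionPS, ⟨S, (Set.infinite_range_of_injective hinj).mono hS, hmin⟩, ?_, ?_,
    fun _ => ⟨S, hmin, _, hS, ?_, ?_⟩⟩
  · exact Cardinal.mk_le_aleph0.trans (Cardinal.aleph0_le_mk _)
  · rcases (le_sup_right : commutator G ≤ elementaryKernel G).eq_or_lt with h | h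
    · exact Or.inl h.ge
    · exact Or.inr ⟨h, le_rfl⟩
  · have := (Set.infinite_range_of_injective hinj).to_subtype
    have := (Set.countable_range fun n => (a n : G ⧸ elementaryKernel G)).to_subtype
    have : Countable (G ⧸ elementaryKernel G) := QuotientGroup.mk_surjective.countable
    rw [Cardinal.mk_eq_aleph0, Cardinal.mk_eq_aleph0]
  · rintro _ ⟨n, rfl⟩
    refine ⟨a n, rfl, orderOf_eq_prime (ha n) fun h => ?_⟩
    have h1 := hε n n
    rw [h, map_one, if_pos rfl] at h1
    exact absurd h1 (by decide)

/-- Lift each element `b` of a basis of `G / G ^ 2 G'` to some `h b`, choosing the involution `a n`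
if `b` is the class of `a n`. Place `h b` at a point of `Y₁` and an element `g b` of `G ^ 2 G'` at a
point of `Y₂`, where `g b` runs through the whole countable subgroup `G ^ 2 G'` as `b` runs through
the classes of the `a n`, and is trivial for all other `b`. These elements and `A` generate the
wreath product. -/
theorem exists_isMinimalGeneratingSet_permWreath [Countable G] (hY : ConjugateBlocks A Y₁ Y₂)
    (ha : ∀ n, a n ^ 2 = 1) (hε : ∀ m n, ε m (a n) = if m = n then -1 else 1) :
    ∃ S : Set (PermWreath A G), IsMinimalGeneratingSet S := by
  classical
  have := Fintype.ofFinite Y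
  obtain ⟨B, hB, hmin⟩ := exists_isMinimalGeneratingSet_range_subset hε
  have hinj := mk_injective_of_dual hε
  obtain ⟨w, hw⟩ := exists_surjective_nat (elementaryKernel G)
  have hlift : ∀ b : G ⧸ elementaryKernel G, ∃ h : G, ∃ g : elementaryKernel G, (h : G ⧸ elementaryKernel G) = b ∧ (h ^ 2 = 1 ∨ g = 1) ∧
      ∀ n, (a n : G ⧸ elementaryKernel G) = b → g = w n := by
    intro b
    by_cases hb : ∃ n, (a n : G ⧸ elementaryKernel G) = b
    · obtain ⟨n, hn⟩ := hb
      exact ⟨a n, w n, hn, Or.inl (ha n), fun m hm => by rw [hinj (hn.trans hm.symm)]⟩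
    · obtain ⟨h, rfl⟩ := QuotientGroup.mk_surjective b
      exact ⟨h, 1, rfl, Or.inr rfl, fun n hn => absurd ⟨n, hn⟩ hb⟩
  choose h g hh hhg hgw using hlift
  obtain ⟨y₁, hy₁⟩ : Y₁.Nonempty := Set.nonempty_of_ncard_ne_zero (by have := hY.three_le_ncard; omega)
  obtain ⟨y₂, hy₂⟩ : Y₂.Nonempty :=
    Set.nonempty_of_ncard_ne_zero (by have := hY.three_le_ncard; have := hY.ncard_eq; omega)
  let _ : CommGroup (G ⧸ elementaryKernel G) :=
    { (inferInstance : Group (G ⧸ elementaryKernel G)) with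
      mul_comm :=
        (Subgroup.Normal.quotient_commutative_iff_commutator_le.2 le_sup_right).is_comm.comm }
  let pr : (Y → G) →* G ⧸ elementaryKernel G :=
    { toFun := fun f => ∏ y, (f y : G ⧸ elementaryKernel G)
      map_one' := by simp
      map_mul' := fun f f' => by simp [Finset.prod_mul_distrib] }
  let φ : PermWreath A G →* G ⧸ elementaryKernel G := SemidirectProduct.lift pr 1 fun σ => by
    ext f
    change ∏ y, (f ((σ⁻¹ : A) • y) : G ⧸ elementaryKernel G) = 1 * pr f * 1⁻¹
    rw [one_mul, inv_one, mul_one]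
    exact Equiv.prod_comp (MulAction.toPerm (σ⁻¹ : A)) fun y => (f y : G ⧸ elementaryKernel G)
  have hpr : ∀ y x, pr (Pi.mulSingle y x) = x := by
    intro y x
    refine (Finset.prod_eq_single_of_mem y (Finset.mem_univ _) fun z _ hz => ?_).trans (by simp)
    simp [Pi.mulSingle_eq_of_ne hz]
  let s : G ⧸ elementaryKernel G → PermWreath A G := fun b =>
    SemidirectProduct.inl (Pi.mulSingle y₁ (h b) * Pi.mulSingle y₂ (g b : G))
  have hs : ∀ b, φ (s b) = b := by
    intro b
    rw [SemidirectProduct.lift_inl, map_mul, hpr, hpr, hh, (QuotientGroup.eq_one_iff _).2 (g b).2,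
      mul_one]
  refine exists_isMinimalGeneratingSet_of_union φ hmin (s := s) (fun b _ => hs b)
    (F := Set.range (SemidirectProduct.inr : A →* PermWreath A G)) (Set.finite_range _) ?_
    (fun b => ⟨s b, hs b⟩) ?_
  · rintro _ ⟨σ, rfl⟩
    simp [φ]
  set K := Subgroup.closure (s '' B ∪ Set.range (SemidirectProduct.inr : A →* PermWreath A G))
  have hinr : ∀ σ, SemidirectProduct.inr σ ∈ K := fun σ =>
    Subgroup.subset_closure (Or.inr ⟨σ, rfl⟩)
  have htop : K.comap SemidirectProduct.inl = ⊤ := by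
    refine eq_top_of_wreath_generators (A := A) (k := 2) (ι := B) (K.comap SemidirectProduct.inl)
      ?_ hY hy₁ hy₂ (h := fun b => h b) (g := fun b => g b) ?_ (fun b => (g b).2)
      (fun b => (hhg b).imp_right fun h => by rw [h]; rfl)
      fun b => Subgroup.subset_closure (Or.inl ⟨b, b.2, rfl⟩)
    · intro σ hσ y y' x x' hx
      have hact : ∀ z v, (mulAutArrow : A →* MulAut (Y → G)) ⟨σ, hσ⟩ (Pi.mulSingle z v) =
          Pi.mulSingle (σ z) v := by
        intro z v
        funext u
        change (Pi.mulSingle z v : Y → G) (σ⁻¹ u) = _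
        simp only [Pi.mulSingle_apply, Equiv.Perm.inv_eq_iff_eq]
      rw [Subgroup.mem_comap, ← hact, ← hact, ← map_mul, SemidirectProduct.inl_aut]
      exact mul_mem (mul_mem (hinr _) hx) (hinr _)
    · set L := Subgroup.closure ((Set.range fun b : B => h b) ∪ Set.range fun b : B => (g b : G))
      have hNL : elementaryKernel G ≤ L := by
        intro x hx
        obtain ⟨n, hn⟩ := hw ⟨x, hx⟩
        refine Subgroup.subset_closure (Or.inr ⟨⟨_, hB ⟨n, rfl⟩⟩, ?_⟩)
        exact congrArg Subtype.val ((hgw _ n rfl).trans hn)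
      have hmap : L.map (QuotientGroup.mk' (elementaryKernel G)) = ⊤ := by
        rw [← top_le_iff, ← hmin.prop, Subgroup.closure_le]
        exact fun b hb => ⟨h b, Subgroup.subset_closure (Or.inl ⟨⟨b, hb⟩, rfl⟩), hh b⟩
      have := congrArg (Subgroup.comap (QuotientGroup.mk' (elementaryKernel G))) hmap
      rwa [Subgroup.comap_map_eq, QuotientGroup.ker_mk', sup_eq_left.2 hNL, Subgroup.comap_top] at this
  refine top_le_iff.1 fun x _ => ?_
  rw [← SemidirectProduct.inl_left_mul_inr_right x]
  exact mul_mem (htop.ge (Subgroup.mem_top x.left)) (hinr _)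

end

namespace RegTree

variable {X : Type*}

/-! ### Wreath recursion -/

theorem ext_words {g h : TreeAut X} (H : ∀ v, g.1 v = h.1 v) : g = h :=
  Subtype.ext (Equiv.ext H)

theorem mul_apply (g h : TreeAut X) (v : List X) : (g * h).1 v = g.1 (h.1 v) := rfl

theorem inv_apply_apply (g : TreeAut X) (v : List X) : (g⁻¹).1 (g.1 v) = v := by simp

theorem apply_inv_apply (g : TreeAut X) (v : List X) : g.1 ((g⁻¹).1 v) = v := by simp

theorem state_state (g : TreeAut X) (v w : List X) : state (state g v) w = state g (v ++ w) :=
  (state_unique fun u => by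
    rw [List.append_assoc, apply_append_state, apply_append_state, apply_append_state g v,
      List.append_assoc]).symm

theorem state_nil (g : TreeAut X) : state g [] = g :=
  state_unique fun u => by rw [g.2.1]; rfl

theorem exists_apply_singleton (g : TreeAut X) (x : X) : ∃ y, g.1 [x] = [y] :=
  List.length_eq_one_iff.1 (length_apply g [x])

/-- The action of a tree automorphism on the words of length one. -/
noncomputable def rootPerm : TreeAut X →* Equiv.Perm X :=
  MonoidHom.toHomPerm
    { toFun := fun g x => (exists_apply_singleton g x).choose
      map_one' := by
        funext x
        have := (exists_apply_singleton 1 x).choose_spec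
        exact (List.singleton_inj.1 this).symm
      map_mul' := fun g h => by
        funext x
        apply List.singleton_inj.1
        change _ = [(exists_apply_singleton g (exists_apply_singleton h x).choose).choose]
        rw [← (exists_apply_singleton (g * h) x).choose_spec,
          ← (exists_apply_singleton g _).choose_spec, ← (exists_apply_singleton h x).choose_spec]
        rfl }

theorem apply_singleton (g : TreeAut X) (x : X) : g.1 [x] = [rootPerm g x] :=
  (exists_apply_singleton g x).choose_spec

theorem apply_cons (g : TreeAut X) (x : X) (u : List X) :
    g.1 (x :: u) = rootPerm g x :: (state g [x]).1 u := by
  have := apply_append_state g [x] u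
  rwa [apply_singleton] at this

theorem adj_cons (x y : X) (u v : List X) :
    (tree X).Adj (x :: u) (y :: v) ↔ x = y ∧ (tree X).Adj u v := by
  simp only [tree, List.cons_append, List.cons.injEq]
  constructor
  · rintro (⟨z, rfl, h⟩ | ⟨z, rfl, h⟩)
    exacts [⟨rfl, Or.inl ⟨z, h⟩⟩, ⟨rfl, Or.inr ⟨z, h⟩⟩]
  · rintro ⟨rfl, ⟨z, h⟩ | ⟨z, h⟩⟩
    exacts [Or.inl ⟨z, rfl, h⟩, Or.inr ⟨z, rfl, h⟩]

theorem adj_nil_cons (y : X) (v : List X) : (tree X).Adj [] (y :: v) ↔ v = [] := by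
  simp [tree]

/-- The tree automorphism acting by `σ` on the first letter, with states `f x` at the words `x` of
length one. -/
def node (σ : Equiv.Perm X) (f : X → TreeAut X) : TreeAut X :=
  ⟨{ toFun := fun
      | [] => []
      | x :: u => σ x :: (f x).1 u
     invFun := fun
      | [] => []
      | x :: u => σ⁻¹ x :: ((f (σ⁻¹ x))⁻¹).1 u
     left_inv := fun
      | [] => rfl
      | x :: u => by simp
     right_inv := fun
      | [] => rfl
      | x :: u => by simp }, by
    refine ⟨rfl, ?_⟩
    rintro (_ | ⟨x, u⟩) (_ | ⟨y, v⟩)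
    · exact (iff_of_false ((tree X).irrefl) ((tree X).irrefl))
    · change (tree X).Adj [] (σ y :: (f y).1 v) ↔ _
      rw [adj_nil_cons, adj_nil_cons, ← List.length_eq_zero_iff, length_apply,
        List.length_eq_zero_iff]
    · change (tree X).Adj (σ x :: (f x).1 u) [] ↔ _
      rw [(tree X).adj_comm, adj_nil_cons, (tree X).adj_comm, adj_nil_cons,
        ← List.length_eq_zero_iff, length_apply, List.length_eq_zero_iff]
    · change (tree X).Adj (σ x :: (f x).1 u) (σ y :: (f y).1 v) ↔ _
      rw [adj_cons, adj_cons, σ.injective.eq_iff]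
      refine and_congr_right ?_
      rintro rfl
      exact (f x).2.2 u v⟩

theorem node_cons (σ : Equiv.Perm X) (f : X → TreeAut X) (x : X) (u : List X) :
    (node σ f).1 (x :: u) = σ x :: (f x).1 u := rfl

theorem rootPerm_node (σ : Equiv.Perm X) (f : X → TreeAut X) : rootPerm (node σ f) = σ := by
  ext x
  have h := apply_singleton (node σ f) x
  rw [node_cons, (f x).2.1] at h
  exact (List.singleton_inj.1 h).symm

theorem state_node_singleton (σ : Equiv.Perm X) (f : X → TreeAut X) (x : X) :
    state (node σ f) [x] = f x :=
  state_unique fun u => by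
    rw [apply_singleton, rootPerm_node]
    rfl

theorem state_node_cons (σ : Equiv.Perm X) (f : X → TreeAut X) (x : X) (u : List X) :
    state (node σ f) (x :: u) = state (f x) u := by
  rw [← state_node_singleton σ f x, state_state]
  rfl

theorem eq_of_rootPerm_of_state {g h : TreeAut X} (hr : rootPerm g = rootPerm h)
    (hs : ∀ x, state g [x] = state h [x]) : g = h := by
  refine ext_words fun v => ?_
  cases v with
  | nil => rw [g.2.1, h.2.1]
  | cons x u => rw [apply_cons, apply_cons, hr, hs]

/-! ### Groups closed under wreath recursion -/

/-- A group of tree automorphisms that the wreath recursion identifies with its permutational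
wreath product with the full symmetric group of the alphabet. -/
structure IsRegularBranching (G : Subgroup (TreeAut X)) : Prop where
  isSelfSimilar : IsSelfSimilar G
  node_mem : ∀ (σ : Equiv.Perm X) (f : X → TreeAut X), (∀ x, f x ∈ G) → node σ f ∈ G

theorem exists_mem_apply_state_eq {G : Subgroup (TreeAut X)} (hG : IsRegularBranching G) (n : ℕ)
    (a : TreeAut X) (f : List X → TreeAut X) (hf : ∀ v, f v ∈ G) :
    ∃ g ∈ G, ∀ v, v.length = n → g.1 v = a.1 v ∧ state g v = f v := by
  induction n generalizing a f with
  | zero =>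
    refine ⟨f [], hf [], fun v hv => ?_⟩
    obtain rfl := List.length_eq_zero_iff.1 hv
    exact ⟨(f []).2.1.trans a.2.1.symm, state_nil _⟩
  | succ n ih =>
    choose b hb hbv using fun x => ih (state a [x]) (fun u => f (x :: u)) fun u => hf _
    refine ⟨node (rootPerm a) b, hG.node_mem _ _ hb, fun v hv => ?_⟩
    cases v with
    | nil => simp at hv
    | cons x u =>
      obtain ⟨h1, h2⟩ := hbv x u (by simpa using hv)
      rw [node_cons, state_node_cons, apply_cons, h1]
      exact ⟨rfl, h2⟩

theorem eq_of_level (n : ℕ) {g h : TreeAut X}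
    (H : ∀ v, v.length = n → g.1 v = h.1 v ∧ state g v = state h v) : g = h := by
  induction n generalizing g h with
  | zero => simpa [state_nil] using (H [] rfl).2
  | succ n ih =>
    have H' : ∀ x u, u.length = n → rootPerm g x = rootPerm h x ∧
        (state g [x]).1 u = (state h [x]).1 u := by
      intro x u hu
      have := (H (x :: u) (by simp [hu])).1
      rw [apply_cons, apply_cons] at this
      exact List.cons.inj this
    refine eq_of_rootPerm_of_state
      (Equiv.ext fun x => (H' x (List.replicate n x) List.length_replicate).1)
      fun x => ih fun u hu => ⟨(H' x u hu).2, ?_⟩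
    rw [state_state, state_state]
    exact (H (x :: u) (by simp [hu])).2

section Level

variable {n : ℕ} {Y : Type*} (w : Y ≃ {v : List X // v.length = n})

/-- The action of a tree automorphism on the `n`-th level of the tree, the words of length `n`
being labelled by `Y`. -/
def levelPerm : TreeAut X →* Equiv.Perm Y :=
  MonoidHom.toHomPerm
    { toFun := fun g y => w.symm ⟨g.1 (w y), (length_apply g _).trans (w y).2⟩
      map_one' := by
        funext y
        exact w.symm_apply_apply y
      map_mul' := fun g h => by
        funext y
        change w.symm ⟨g.1 (h.1 (w y)), _⟩ = w.symm ⟨g.1 (w (w.symm ⟨h.1 (w y), _⟩)), _⟩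
        simp }

theorem coe_levelPerm (g : TreeAut X) (y : Y) : (w (levelPerm w g y) : List X) = g.1 (w y) := by
  change ((w (w.symm _) : {v : List X // v.length = n}) : List X) = _
  rw [Equiv.apply_symm_apply]

/-- The decomposition of a group closed under wreath recursion according to the action on
the `n`-th level and the states there. As `A` acts on functions by `(a • f) y = f (a⁻¹ y)`,
the coordinate of `g` at `y` is its state at `g⁻¹ y`. -/
noncomputable def levelEquiv {G : Subgroup (TreeAut X)} (hG : IsRegularBranching G) :
    G ≃* PermWreath (levelPerm w).range G :=
  MulEquiv.ofBijective
    (MonoidHom.mk' (fun g : G => (⟨fun y => ⟨state g.1 (w ((levelPerm w g.1)⁻¹ y)),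
        hG.isSelfSimilar g.1 g.2 _⟩, ⟨levelPerm w g.1, g.1, rfl⟩⟩ :
          PermWreath (levelPerm w).range G)) fun g h => by
      refine SemidirectProduct.ext ?_ (Subtype.ext (map_mul (levelPerm w) g.1 h.1))
      funext y
      refine Subtype.ext ?_
      change state (g.1 * h.1) _ = state g.1 _ * 
        state h.1 (w ((levelPerm w h.1)⁻¹ ((levelPerm w g.1)⁻¹ y)))
      rw [state_mul, ← coe_levelPerm,
        show levelPerm w (g * h).1 = levelPerm w g.1 * levelPerm w h.1 from map_mul _ _ _]
      simp)
    ⟨(injective_iff_map_eq_one _).2 fun g hg => by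
      have hperm : levelPerm w g.1 = 1 := congrArg (fun p => (p.right : Equiv.Perm Y)) hg
      refine Subtype.ext (eq_of_level n fun v hv => ?_)
      obtain ⟨y, hy⟩ := w.surjective ⟨v, hv⟩
      obtain rfl : (w y : List X) = v := congrArg Subtype.val hy
      refine ⟨?_, ?_⟩
      · rw [← coe_levelPerm, hperm]
        rfl
      · have h := congrArg (fun p => (p.left y : TreeAut X)) hg
        change state g.1 (w ((levelPerm w g.1)⁻¹ y)) = 1 at h
        rw [hperm] at h
        exact h.trans (state_one _).symm,
    fun p => by
      classical
      obtain ⟨f, ⟨_, a, rfl⟩⟩ := p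
      obtain ⟨g, hg, hga⟩ := exists_mem_apply_state_eq hG n a
        (fun v => if hv : v.length = n then f (levelPerm w a (w.symm ⟨v, hv⟩)) else 1) fun v => by
          split_ifs
          exacts [SetLike.coe_mem _, one_mem _]
      have hperm : levelPerm w g = levelPerm w a := by
        ext y
        apply w.injective
        apply Subtype.ext
        rw [coe_levelPerm, coe_levelPerm]
        exact (hga _ (w y).2).1
      refine ⟨⟨g, hg⟩, SemidirectProduct.ext ?_ (Subtype.ext hperm)⟩
      funext y
      apply Subtype.ext
      change state g (w ((levelPerm w g)⁻¹ y)) = f y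
      rw [(hga _ (w _).2).2, dif_pos (w _).2, hperm]
      simp⟩

end Level

/-! ### Blocks of the third level -/

theorem exists_apply_eq : ∀ u v : List X, u.length = v.length → ∃ g : TreeAut X, g.1 u = v := by
  classical
  intro u
  induction u with
  | nil => exact fun v hv => ⟨1, (List.length_eq_zero_iff.1 hv.symm).symm⟩
  | cons x u ih =>
    rintro (_ | ⟨y, v⟩) hv
    · simp at hv
    · obtain ⟨g, hg⟩ := ih v (by simpa using hv)
      exact ⟨node (Equiv.swap x y) fun _ => g, by rw [node_cons, hg, Equiv.swap_apply_left]⟩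

theorem exists_apply_cons_eq (x : X) (u v : List X) (h : u.length = v.length) :
    ∃ g : TreeAut X, g.1 (x :: u) = x :: v ∧ ∀ y ≠ x, ∀ t, g.1 (y :: t) = y :: t := by
  classical
  obtain ⟨g, hg⟩ := exists_apply_eq u v h
  refine ⟨node 1 (Pi.mulSingle x g), ?_, fun y hy t => ?_⟩
  · rw [node_cons, Pi.mulSingle_eq_same, hg]
    rfl
  · rw [node_cons, Pi.mulSingle_eq_of_ne hy]
    rfl

section Blocks

variable {Y : Type*} (w : Y ≃ {v : List X // v.length = 3})

/-- The set of labels of the words of length three with first letter `x`. -/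
def block (x : X) : Set Y := {y | ∃ u, (w y : List X) = x :: u}

theorem levelPerm_eq_of_apply {g : TreeAut X} {y y' : Y} (h : g.1 (w y) = w y') :
    levelPerm w g y = y' :=
  w.injective (Subtype.ext ((coe_levelPerm w g y).trans h))

theorem block_transitive (x : X) : ∀ y ∈ block w x, ∀ y' ∈ block w x,
    ∃ a ∈ (levelPerm w).range, a y = y' ∧ ∀ z ∉ block w x, a z = z := by
  rintro y ⟨u, hu⟩ y' ⟨v, hv⟩
  have hlu := (w y).2
  have hlv := (w y').2
  rw [hu] at hlu
  rw [hv] at hlv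
  obtain ⟨g, hg, hfix⟩ := exists_apply_cons_eq x u v (by simpa using hlu.trans hlv.symm)
  refine ⟨_, ⟨g, rfl⟩, levelPerm_eq_of_apply w (by rw [hu, hv, hg]), fun z hz =>
    levelPerm_eq_of_apply w ?_⟩
  cases ht : (w z : List X) with
  | nil =>
    have := (w z).2
    simp [ht] at this
  | cons p t =>
    refine hfix p ?_ t
    rintro rfl
    exact hz ⟨t, ht⟩

theorem conjugateBlocks [Finite X] {x₀ x₁ : X} (hne : x₀ ≠ x₁) :
    ConjugateBlocks (levelPerm w).range (block w x₀) (block w x₁) where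
  trans y y' := by
    obtain ⟨g, hg⟩ := exists_apply_eq (w y : List X) (w y') ((w y).2.trans (w y').2.symm)
    exact ⟨_, ⟨g, rfl⟩, levelPerm_eq_of_apply w hg⟩
  disjoint := by
    rw [Set.disjoint_left]
    rintro y ⟨u, hu⟩ ⟨v, hv⟩
    exact hne (List.cons.inj (hu.symm.trans hv)).1
  trans_left := block_transitive w x₀
  trans_right := block_transitive w x₁
  three_le_ncard := by
    have : Finite {v : List X // v.length = 3} := (List.finite_length_eq X 3).to_subtype
    have : Finite Y := Finite.of_equiv _ w.symm
    refine (Set.two_lt_ncard_iff (Set.toFinite _)).2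
      ⟨w.symm ⟨[x₀, x₀, x₀], rfl⟩, w.symm ⟨[x₀, x₀, x₁], rfl⟩, w.symm ⟨[x₀, x₁, x₀], rfl⟩,
        ⟨[x₀, x₀], by simp⟩, ⟨[x₀, x₁], by simp⟩, ⟨[x₁, x₀], by simp⟩, ?_, ?_, ?_⟩ <;>
    simp [hne, hne.symm]
  conj := by
    classical
    refine ⟨_, ⟨node (Equiv.swap x₀ x₁) 1, rfl⟩, Set.Subset.antisymm ?_ ?_⟩
    · rintro _ ⟨y, ⟨u, hu⟩, rfl⟩
      refine ⟨u, ?_⟩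
      rw [coe_levelPerm, hu, node_cons, Equiv.swap_apply_right]
      rfl
    · rintro y ⟨u, hu⟩
      have hl := (w y).2
      rw [hu] at hl
      refine ⟨w.symm ⟨x₁ :: u, hl⟩, ⟨u, by simp⟩, levelPerm_eq_of_apply w ?_⟩
      rw [Equiv.apply_symm_apply, node_cons, Equiv.swap_apply_right, hu]
      rfl

end Blocks

/-! ### Sign characters -/

/-- The product of the signs of the local permutations of a tree automorphism at all words of
length `n`. -/
noncomputable def levelSign [Fintype X] [DecidableEq X] : ℕ → TreeAut X →* ℤˣ
  | 0 => Equiv.Perm.sign.comp rootPerm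
  | n + 1 =>
    { toFun := fun g => ∏ x, levelSign n (state g [x])
      map_one' := by simp [state_one]
      map_mul' := fun g h => by
        simp only [state_mul, apply_singleton, map_mul, Finset.prod_mul_distrib]
        congr 1
        exact Equiv.prod_comp (rootPerm h) fun x => levelSign n (state g [x]) }

theorem node_mul (σ τ : Equiv.Perm X) (f g : X → TreeAut X) :
    node σ f * node τ g = node (σ * τ) fun x => f (τ x) * g x := by
  refine ext_words fun v => ?_
  cases v <;> rfl

theorem node_one : node 1 (1 : X → TreeAut X) = 1 := by
  refine ext_words fun v => ?_
  cases v <;> rfl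

/-- The tree automorphism whose only nontrivial local permutation is the transposition of `x₀` and
`x₁` at the word `x₀ ⋯ x₀` of length `n`. -/
def levelSwap [DecidableEq X] (x₀ x₁ : X) : ℕ → TreeAut X
  | 0 => node (Equiv.swap x₀ x₁) 1
  | n + 1 => node 1 (Pi.mulSingle x₀ (levelSwap x₀ x₁ n))

theorem levelSwap_sq [DecidableEq X] (x₀ x₁ : X) (n : ℕ) : levelSwap x₀ x₁ n ^ 2 = 1 := by
  induction n with
  | zero =>
    rw [sq, levelSwap, node_mul, Equiv.swap_mul_self, ← node_one]
    congr 1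
  | succ n ih =>
    rw [sq, levelSwap, node_mul, one_mul, ← node_one]
    congr 1
    change (Pi.mulSingle x₀ (levelSwap x₀ x₁ n) * Pi.mulSingle x₀ (levelSwap x₀ x₁ n) :
      X → TreeAut X) = 1
    rw [← Pi.mulSingle_mul, ← sq, ih, Pi.mulSingle_one]

theorem levelSign_levelSwap [Fintype X] [DecidableEq X] {x₀ x₁ : X} (hne : x₀ ≠ x₁) (m n : ℕ) :
    levelSign m (levelSwap x₀ x₁ n) = if m = n then -1 else 1 := by
  induction m generalizing n with
  | zero =>
    cases n with
    | zero => simp [levelSign, levelSwap, rootPerm_node, Equiv.Perm.sign_swap hne]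
    | succ n => simp [levelSign, levelSwap, rootPerm_node]
  | succ m ih =>
    cases n with
    | zero => simp [levelSign, levelSwap, state_node_singleton]
    | succ n =>
      change ∏ x, levelSign m (state (node 1 _) [x]) = _
      simp only [state_node_singleton]
      rw [Finset.prod_eq_single_of_mem x₀ (Finset.mem_univ _) fun x _ hx => by
        rw [Pi.mulSingle_eq_of_ne hx, map_one], Pi.mulSingle_eq_same, ih]
      simp

theorem levelSwap_mem [DecidableEq X] {G : Subgroup (TreeAut X)} (hG : IsRegularBranching G)
    (x₀ x₁ : X) (n : ℕ) : levelSwap x₀ x₁ n ∈ G := by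
  induction n with
  | zero => exact hG.node_mem _ _ fun x => one_mem G
  | succ n ih =>
    refine hG.node_mem _ _ fun x => ?_
    rw [Pi.mulSingle_apply]
    split_ifs
    exacts [ih, one_mem G]

theorem IsRegularBranching.lCondition_and_exists [Finite X] [Nontrivial X]
    {G : Subgroup (TreeAut X)} (hG : IsRegularBranching G) [Countable G] :
    LCondition G ∧ ∃ S : Set G, IsMinimalGeneratingSet S := by
  classical
  have := Fintype.ofFinite X
  obtain ⟨x₀, x₁, hne⟩ := exists_pair_ne X
  have : Finite {v : List X // v.length = 3} := (List.finite_length_eq X 3).to_subtype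
  obtain ⟨N, ⟨w⟩⟩ := Finite.exists_equiv_fin {v : List X // v.length = 3}
  let e := levelEquiv w.symm hG
  have hY := conjugateBlocks w.symm hne
  let a : ℕ → G := fun n => ⟨levelSwap x₀ x₁ n, levelSwap_mem hG x₀ x₁ n⟩
  have ha : ∀ n, a n ^ 2 = 1 := fun n => Subtype.ext (levelSwap_sq x₀ x₁ n)
  have hε : ∀ m n, ((levelSign m).comp G.subtype) (a n) = if m = n then -1 else 1 :=
    levelSign_levelSwap hne
  obtain ⟨S, hS⟩ := exists_isMinimalGeneratingSet_permWreath hY ha hε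
  exact ⟨lCondition_of_dual e hY ha hε, _, hS.image e.symm⟩

/-! ### The groups of automata are closed under wreath recursion -/

theorem isRegularBranching_fAut [Finite X] : IsRegularBranching (FAut X) where
  isSelfSimilar g hg v := Set.Finite.subset hg (by
    rintro _ ⟨u, rfl⟩
    exact ⟨v ++ u, (state_state g v u).symm⟩)
  node_mem σ f hf := by
    refine ((Set.finite_singleton (node σ f)).union (Set.finite_iUnion hf)).subset ?_
    rintro _ ⟨_ | ⟨x, u⟩, rfl⟩
    · exact Or.inl (state_nil _)
    · exact Or.inr (Set.mem_iUnion.2 ⟨x, u, (state_node_cons σ f x u).symm⟩)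

theorem activity_state_le [Finite X] (g : TreeAut X) (v : List X) (n : ℕ) :
    activity (state g v) n ≤ activity g (v.length + n) := by
  refine Set.ncard_le_ncard_of_injOn (v ++ ·) ?_ (List.append_right_injective v).injOn
    (finite_active g _)
  rintro u ⟨rfl, hu⟩
  exact ⟨List.length_append, state_state g v u ▸ hu⟩

theorem activity_zero_le (g : TreeAut X) : activity g 0 ≤ 1 := by
  refine (Set.ncard_le_ncard (t := {[]}) ?_ (Set.finite_singleton _)).trans
    (Set.ncard_singleton _).le
  exact fun v hv => List.length_eq_zero_iff.1 hv.1

theorem activity_node_le [Fintype X] (σ : Equiv.Perm X) (f : X → TreeAut X) (n : ℕ) :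
    activity (node σ f) (n + 1) ≤ ∑ x, activity (f x) n := by
  have hsub : {v : List X | v.length = n + 1 ∧ state (node σ f) v ≠ 1} ⊆
      ⋃ x, (x :: ·) '' {v : List X | v.length = n ∧ state (f x) v ≠ 1} := by
    rintro (_ | ⟨x, u⟩) ⟨hl, hu⟩
    · simp at hl
    · exact Set.mem_iUnion.2 ⟨x, u, ⟨by simpa using hl, state_node_cons σ f x u ▸ hu⟩, rfl⟩
  refine (Set.ncard_le_ncard hsub
    (Set.finite_iUnion fun x => (finite_active (f x) n).image _)).trans ?_
  refine (Set.ncard_iUnion_le_of_fintype _).trans (Finset.sum_le_sum fun x _ => ?_)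
  exact Set.ncard_image_le (finite_active (f x) n)

theorem isRegularBranching_pol [Finite X] (m : ℕ) : IsRegularBranching (Pol X m) where
  isSelfSimilar := by
    rintro g ⟨hg, p, hp, hpg⟩ v
    refine ⟨isRegularBranching_fAut.isSelfSimilar g hg v,
      p.comp (.X + .C (v.length : ℝ)), ?_, fun n => ?_⟩
    · rw [Polynomial.natDegree_comp, Polynomial.natDegree_X_add_C, mul_one]
      exact hp
    · have h : (activity (state g v) n : ℝ) ≤ activity g (v.length + n) := by
        exact_mod_cast activity_state_le g v n
      refine h.trans ((hpg _).trans_eq ?_)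
      simp [add_comm]
  node_mem σ f hf := by
    have := Fintype.ofFinite X
    choose hF p hp hpf using hf
    -- The polynomials are shifted by one level; the constant term makes the bound hold at level 0.
    let q : Polynomial ℝ := ∑ x, (p x).comp (.X - .C 1)
    refine ⟨isRegularBranching_fAut.node_mem σ f hF, q + .C (1 + |q.eval 0|), ?_, fun n => ?_⟩
    · refine Polynomial.natDegree_add_le_of_degree_le
        (Polynomial.natDegree_sum_le_of_forall_le _ _ fun x _ => ?_) (by simp)
      rw [Polynomial.natDegree_comp, Polynomial.natDegree_X_sub_C, mul_one]
      exact hp x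
    · rw [Polynomial.eval_add, Polynomial.eval_C]
      cases n with
      | zero =>
        have h : (activity (node σ f) 0 : ℝ) ≤ 1 := by exact_mod_cast activity_zero_le _
        have := neg_abs_le (q.eval 0)
        rw [Nat.cast_zero]
        linarith
      | succ n =>
        have h : (activity (node σ f) (n + 1) : ℝ) ≤ ∑ x, (activity (f x) n : ℝ) := by
          exact_mod_cast activity_node_le σ f n
        have hq : q.eval ((n + 1 : ℕ) : ℝ) = ∑ x, (p x).eval (n : ℝ) := by
          simp [q, Polynomial.eval_finsetSum]
        have := Finset.sum_le_sum fun x (_ : x ∈ Finset.univ) => hpf x n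
        have := abs_nonneg (q.eval 0)
        linarith

theorem isRegularBranching_polInf [Finite X] : IsRegularBranching (PolInf X) where
  isSelfSimilar g hg v := by
    obtain ⟨m, hm⟩ := Set.mem_iUnion.1 hg
    exact Set.mem_iUnion.2 ⟨m, (isRegularBranching_pol m).isSelfSimilar g hm v⟩
  node_mem σ f hf := by
    have := Fintype.ofFinite X
    choose m hm using fun x => Set.mem_iUnion.1 (hf x)
    exact Set.mem_iUnion.2 ⟨Finset.univ.sup m, (isRegularBranching_pol _).node_mem σ f fun x =>
      pol_mono (Finset.le_sup (Finset.mem_univ x)) (hm x)⟩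

theorem isSelfSimilar_closure {S : Set (TreeAut X)}
    (hS : ∀ s ∈ S, ∀ v, state s v ∈ Subgroup.closure S) : IsSelfSimilar (Subgroup.closure S) := by
  intro g hg
  induction hg using Subgroup.closure_induction with
  | mem s hs => exact hS s hs
  | one => exact fun v => by rw [state_one]; exact one_mem _
  | mul g h _ _ hg hh => exact fun v => by rw [state_mul]; exact mul_mem (hg _) (hh _)
  | inv g _ hg => exact fun v => by rw [state_inv]; exact inv_mem (hg _)

theorem isRegularBranching_rAut [Finite X] : IsRegularBranching (RAut X) where
  isSelfSimilar := by
    rintro g ⟨K, hK, hKs, hg⟩ v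
    exact ⟨K, hK, hKs, hKs g hg v⟩
  node_mem σ f hf := by
    choose K hK hKs hf using hf
    choose T hT hTf using fun x => (Subgroup.fg_iff _).1 (hK x)
    have hle : ∀ x, K x ≤ Subgroup.closure ({node σ f} ∪ ⋃ x, T x) := fun x => by
      rw [← hT x]
      exact Subgroup.closure_mono
        ((Set.subset_iUnion T x).trans Set.subset_union_right)
    refine ⟨Subgroup.closure ({node σ f} ∪ ⋃ x, T x),
      (Subgroup.fg_iff _).2 ⟨_, rfl, (Set.finite_singleton _).union (Set.finite_iUnion hTf)⟩,
      isSelfSimilar_closure ?_, Subgroup.subset_closure (Or.inl rfl)⟩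
    rintro s (rfl | hs) v
    · cases v with
      | nil =>
        rw [state_nil]
        exact Subgroup.subset_closure (Or.inl rfl)
      | cons x u =>
        rw [state_node_cons]
        exact hle x (hKs x _ (hf x) u)
    · obtain ⟨x, hx⟩ := Set.mem_iUnion.1 hs
      exact hle x (hKs x s (hT x ▸ Subgroup.subset_closure hx) v)

/-! ### Countability -/

theorem fAut_le_rAut : FAut X ≤ RAut X := fun g hg =>
  ⟨Subgroup.closure (Set.range (state g)), (Subgroup.fg_iff _).2 ⟨_, rfl, hg⟩,
    isSelfSimilar_closure (by
      rintro _ ⟨v, rfl⟩ u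
      exact Subgroup.subset_closure ⟨v ++ u, (state_state g v u).symm⟩),
    Subgroup.subset_closure ⟨[], state_nil g⟩⟩

/-- The tuple `t` of tree automorphisms satisfies the wreath recursion given by the root
permutations `σ i` and the group words `W i x` in `t` for the states at the words `x` of
length one. -/
def SatisfiesRecursion {ι : Type*} (σ : ι → Equiv.Perm X) (W : ι → X → FreeGroup ι)
    (t : ι → TreeAut X) : Prop :=
  ∀ i, rootPerm (t i) = σ i ∧ ∀ x, state (t i) [x] = FreeGroup.lift t (W i x)

/-- A wreath recursion has at most one solution: by induction on the length, two solutions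
act in the same way on all words. -/
theorem SatisfiesRecursion.unique {ι : Type*} {σ : ι → Equiv.Perm X} {W : ι → X → FreeGroup ι}
    {t t' : ι → TreeAut X} (ht : SatisfiesRecursion σ W t) (ht' : SatisfiesRecursion σ W t') :
    t = t' := by
  have key : ∀ n (c : FreeGroup ι) (u : List X), u.length = n →
      (FreeGroup.lift t c).1 u = (FreeGroup.lift t' c).1 u := by
    intro n
    induction n with
    | zero =>
      intro c u hu
      obtain rfl := List.length_eq_zero_iff.1 hu
      rw [(FreeGroup.lift t c).2.1, (FreeGroup.lift t' c).2.1]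
    | succ n ih =>
      intro c
      induction c using FreeGroup.induction_on with
      | C1 => simp
      | of i =>
        rintro (_ | ⟨x, u⟩) hu
        · simp at hu
        · simp only [FreeGroup.lift_apply_of]
          rw [apply_cons, apply_cons, (ht i).1, (ht' i).1, (ht i).2, (ht' i).2,
            ih _ _ (by simpa using hu)]
      | inv_of i hi =>
        intro u hu
        rw [map_inv, map_inv]
        have h := hi (((FreeGroup.lift t' (FreeGroup.of i))⁻¹).1 u) (by rw [length_apply, hu])
        rw [apply_inv_apply] at h
        rw [← h, inv_apply_apply, h]
      | mul c d hc hd =>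
        intro u hu
        rw [map_mul, map_mul, mul_apply, mul_apply, hd u hu, hc _ (by rw [length_apply, hu])]
  funext i
  exact ext_words fun u => by simpa using key _ (FreeGroup.of i) u rfl

/-- A functionally recursive automorphism is determined by a group word in the solution of a
wreath recursion with finitely many unknowns, and there are only countably many of these data. -/
theorem countable_rAut [Finite X] : (RAut X : Set (TreeAut X)).Countable := by
  let D := Σ k : ℕ, (Fin k → Equiv.Perm X) × (Fin k → X → FreeGroup (Fin k)) × FreeGroup (Fin k)
  have hsub : (RAut X : Set (TreeAut X)) ⊆ ⋃ d : D,
      {g | ∃ t, SatisfiesRecursion d.2.1 d.2.2.1 t ∧ FreeGroup.lift t d.2.2.2 = g} := by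
    rintro g ⟨K, hK, hKs, hg⟩
    obtain ⟨T, rfl, hTf⟩ := (Subgroup.fg_iff _).1 hK
    obtain ⟨k, t, rfl⟩ := hTf.fin_embedding
    have hword : ∀ h ∈ Subgroup.closure (Set.range t), ∃ c, FreeGroup.lift t c = h := by
      intro h hh
      rwa [← FreeGroup.range_lift_eq_closure] at hh
    choose W hW using fun i x =>
      hword _ (hKs (t i) (Subgroup.subset_closure (Set.mem_range_self i)) [x])
    obtain ⟨c, hc⟩ := hword g hg
    exact Set.mem_iUnion.2 ⟨⟨k, fun i => rootPerm (t i), W, c⟩, t,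
      fun i => ⟨rfl, fun x => (hW i x).symm⟩, hc⟩
  refine (Set.countable_iUnion fun d => ?_).mono hsub
  refine Set.Subsingleton.countable ?_
  rintro _ ⟨t, ht, rfl⟩ _ ⟨t', ht', rfl⟩
  rw [ht.unique ht']

end RegTree

theorem theorem3 {X : Type*} [Finite X] [Nontrivial X] :
    (LCondition (RegTree.FAut X) ∧
      ∃ S : Set (RegTree.FAut X), IsMinimalGeneratingSet S) ∧
    (∀ m : ℕ, LCondition (RegTree.Pol X m) ∧
      ∃ S : Set (RegTree.Pol X m), IsMinimalGeneratingSet S) ∧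
    (LCondition (RegTree.PolInf X) ∧
      ∃ S : Set (RegTree.PolInf X), IsMinimalGeneratingSet S) ∧
    (LCondition (RegTree.RAut X) ∧
      ∃ S : Set (RegTree.RAut X), IsMinimalGeneratingSet S) := by
  have hcount : ∀ G : Subgroup (RegTree.TreeAut X), G ≤ RegTree.RAut X → Countable G :=
    fun G hG => (RegTree.countable_rAut.mono hG).to_subtype
  have hpol : ∀ m, RegTree.Pol X m ≤ RegTree.RAut X := fun m _ hg => RegTree.fAut_le_rAut hg.1
  have hpolInf : RegTree.PolInf X ≤ RegTree.RAut X := fun g hg => by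
    obtain ⟨m, hm⟩ := Set.mem_iUnion.1 hg
    exact hpol m hm
  have := hcount _ RegTree.fAut_le_rAut
  have := fun m => hcount _ (hpol m)
  have := hcount _ hpolInf
  have := hcount _ le_rfl
  exact ⟨RegTree.isRegularBranching_fAut.lCondition_and_exists,
    fun m => (RegTree.isRegularBranching_pol m).lCondition_and_exists,
    RegTree.isRegularBranching_polInf.lCondition_and_exists,
    RegTree.isRegularBranching_rAut.lCondition_and_exists⟩
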